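/- Let $K$ be a compact Hausdorff space, let the scalar field be $\mathbb R$ or $\mathbb C$, let $X$ be an $n$-dimensional subspace of $C(K)$ with the supremum norm, and let $k\le n$. For a bounded linear operator $T:E\to F$ between normed spaces put $$\pi_2(T)=\sup\Bigl\{\Bigl(\sum_{i=1}^m\|TUe_i\|^2\Bigr)^{1/2} : m\ge 1,\ U:\ell_2^m\to E \text{ linear},\ \|U\|=1\Bigr\},$$ where $(e_i)$ is the unit vector basis of $\ell_2^m$. For a probability measure $\mu$ on $K$ let $I_{\infty,2}:C(K)\to L_2(K,\mu)$ be the canonical map, $X_2=I_{\infty,2}(X)\subset L_2(K,\mu)$ with the $L_2(\mu)$-norm, and $I_{\infty,2}^X:X\to X_2$ the restriction of $I_{\infty,2}$ to $X$. Then $$\sup\Bigl\{\frac{\pi_2(u)}{\|u\|} : u:X\to\ell_2^k \text{ linear}\Bigr\}=\sup\Bigl\{\frac{1}{\|PI_{\infty,2}^X\|} : \mu\in\mathcal P(K),\ P:X_2\to X_2 \text{ linear},\ P^2=P,\ \|P\|=1,\ \operatorname{rank}P\le k,\ \pi_2(PI_{\infty,2}^X)=1\Bigr\},$$ where $\mathcal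 P(K)$ is the set of all regular Borel probability measures on $K$, $\frac00$ is interpreted as $0$, and the supremum of the empty set is $0$ (suprema are taken in $[0,\infty]$). -/

import Mathlib

open MeasureTheory
open scoped ENNReal

/-- The `2`-summing norm of an operator `T : E → F`, as an element of `[0, ∞]`: the supremum of
`(∑ i, ‖T (U e_i)‖ ^ 2) ^ (1 / 2)` over all `m` and all norm-one operators `U : ℓ₂ᵐ → E`,
where `e_i` are the unit vectors of `ℓ₂ᵐ`. -/
noncomputable def twoSummingNorm {𝕜 E F : Type*} [RCLike 𝕜]
    [NormedAddCommGroup E] [NormedSpace 𝕜 E] [NormedAddCommGroup F] [NormedSpace 𝕜 F]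
    (T : E →L[𝕜] F) : ℝ≥0∞ :=
  ⨆ (m : ℕ) (U : EuclideanSpace 𝕜 (Fin m) →L[𝕜] E) (_ : ‖U‖ = 1),
    (∑ i : Fin m, ‖T (U (EuclideanSpace.single i 1))‖ₑ ^ 2) ^ (1 / 2 : ℝ)

section CK

variable {𝕜 K : Type*} [RCLike 𝕜] [TopologicalSpace K] [CompactSpace K]
  [MeasurableSpace K] [BorelSpace K]

/-- The canonical map `I_{∞,2} : C(K) → L₂(K, μ)`. -/
noncomputable def formalId (μ : Measure K) [IsFiniteMeasure μ] :
    C(K, 𝕜) →L[𝕜] Lp 𝕜 2 μ :=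
  ContinuousMap.toLp 2 μ 𝕜

/-- `X₂`: the subspace `X` of `C(K)`, regarded as a subspace of `L₂(K, μ)`. -/
noncomputable abbrev imageL2 (X : Submodule 𝕜 C(K, 𝕜)) (μ : Measure K) [IsFiniteMeasure μ] :
    Submodule 𝕜 (Lp 𝕜 2 μ) :=
  X.map (formalId (𝕜 := 𝕜) μ : C(K, 𝕜) →ₗ[𝕜] Lp 𝕜 2 μ)

/-- `I_{∞,2}^X : X → X₂`: the restriction of `I_{∞,2}` to `X`. -/
noncomputable def formalIdOn (X : Submodule 𝕜 C(K, 𝕜)) (μ : Measure K) [IsFiniteMeasure μ] :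
    X →L[𝕜] imageL2 X μ :=
  ((formalId (𝕜 := 𝕜) μ).comp X.subtypeL).codRestrict (imageL2 X μ)
    (fun x => Submodule.mem_map_of_mem x.2)

end CK

/-! Write `I` for the canonical map X → X₂; integrating a pointwise bound gives π₂(I) ≤ 1. Let u ≠ 0
and p = π₂(u), which is finite and positive. Pietsch domination
(`exists_probabilityMeasure_norm_le`) gives a μ with ‖u x‖ ≤ p‖I x‖, so u/p = v ∘ I for a
contraction v on X₂.

Let P be the orthogonal projection onto the subspace where v is isometric. Its rank is at most k,
and ‖P y‖ ≤ ‖v y‖ gives ‖P I‖ ≤ ‖u‖/p. The point is that π₂(P I) = 1. By finite dimension v is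
uniformly strict on the complement: ‖v y‖² ≤ (1 - δ)‖y‖² + δ‖P y‖² with δ > 0. Summing over the
images of unit vectors gives 1 ≤ (1 - δ) + δ π₂(P I)², hence π₂(P I) ≥ 1.

Conversely, the range of an admissible P embeds isometrically in ℓ₂ᵏ, which turns P I into an
operator u with the same π₂ and the same norm. -/

/-! ### Contractions between Hilbert spaces -/

section Contraction

variable {𝕜 H G : Type*} [RCLike 𝕜] [NormedAddCommGroup H] [InnerProductSpace 𝕜 H]
  [FiniteDimensional 𝕜 H] [NormedAddCommGroup G] [InnerProductSpace 𝕜 G]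

/-- A strict contraction on a finite-dimensional space is a contraction by a factor below one. -/
theorem exists_norm_sq_le_of_forall_norm_lt (v : H →L[𝕜] G)
    (hv : ∀ y, y ≠ 0 → ‖v y‖ < ‖y‖) :
    ∃ δ : ℝ, 0 < δ ∧ δ ≤ 1 ∧ ∀ y, ‖v y‖ ^ 2 ≤ (1 - δ) * ‖y‖ ^ 2 := by
  have : ProperSpace H := FiniteDimensional.proper_rclike 𝕜 H
  have hlt : ‖v‖ < 1 := by
    rcases subsingleton_or_nontrivial H with hH | hH
    · have : v = 0 := by ext y; simp [Subsingleton.elim y 0]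
      simp [this]
    · obtain ⟨y₀, hy₀⟩ := exists_ne (0 : H)
      have hne : (Metric.sphere (0 : H) 1).Nonempty :=
        ⟨((‖y₀‖⁻¹ : ℝ) : 𝕜) • y₀, by
          simp [norm_smul, inv_mul_cancel₀ (norm_ne_zero_iff.2 hy₀)]⟩
      obtain ⟨z, hz, hmax⟩ := (isCompact_sphere (0 : H) 1).exists_isMaxOn hne
        (v.continuous.norm.continuousOn)
      have hz1 : ‖z‖ = 1 := by simpa using hz
      have hz0 : z ≠ 0 := by rintro rfl; simp at hz1
      refine lt_of_le_of_lt (v.opNorm_le_bound (norm_nonneg (v z)) fun y => ?_)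
        ((hv z hz0).trans_eq hz1)
      rcases eq_or_ne y 0 with rfl | hy
      · simp
      have hpos : 0 < ‖y‖ := norm_pos_iff.2 hy
      have := hmax (show ((‖y‖⁻¹ : ℝ) : 𝕜) • y ∈ Metric.sphere (0 : H) 1 by
        simp [norm_smul, inv_mul_cancel₀ hpos.ne'])
      simp only [Set.mem_ofPred_eq, map_smul, norm_smul, RCLike.norm_ofReal, abs_inv,
        abs_norm] at this
      rwa [inv_mul_le_iff₀ hpos, mul_comm] at this
  refine ⟨1 - ‖v‖ ^ 2, by nlinarith [norm_nonneg v], by nlinarith [norm_nonneg v], fun y => ?_⟩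
  have := pow_le_pow_left₀ (norm_nonneg _) (v.le_opNorm y) 2
  nlinarith

/-- A contraction `v` between finite-dimensional Hilbert spaces dominates an orthogonal
projection `P` of rank at most `dim G`, and is uniformly contractive off the range of `P`. -/
theorem exists_projection_of_contraction [FiniteDimensional 𝕜 G] (v : H →L[𝕜] G) (hv : ∀ y, ‖v y‖ ≤ ‖y‖) :
    ∃ (P : H →L[𝕜] H) (δ : ℝ), 0 < δ ∧ δ ≤ 1 ∧ P ∘L P = P ∧ ‖P‖ ≤ 1 ∧
      LinearMap.rank (P : H →ₗ[𝕜] H) ≤ (Module.finrank 𝕜 G : Cardinal) ∧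
      (∀ y, ‖P y‖ ≤ ‖v y‖) ∧ ∀ y, ‖v y‖ ^ 2 ≤ (1 - δ) * ‖y‖ ^ 2 + δ * ‖P y‖ ^ 2 := by
  have : CompleteSpace H := FiniteDimensional.complete 𝕜 H
  have : CompleteSpace G := FiniteDimensional.complete 𝕜 G
  set T : H →L[𝕜] H := v.adjoint ∘L v with hT
  have hinner : ∀ x y, inner 𝕜 (T x) y = inner 𝕜 (v x) (v y) := fun x y => by
    simp [hT, ContinuousLinearMap.adjoint_inner_left]
  -- For a contraction, the vectors whose norm `v` preserves are exactly the fixed vectors of `v*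
  -- v`, hence a subspace.
  let E : Submodule 𝕜 H := LinearMap.eqLocus (T : H →ₗ[𝕜] H) LinearMap.id
  have hE : ∀ {y}, y ∈ E ↔ T y = y := fun {y} => Iff.rfl
  have hvle : ‖v‖ ≤ 1 := v.opNorm_le_bound zero_le_one fun y => by simpa using hv y
  have hmem : ∀ y, ‖v y‖ = ‖y‖ → y ∈ E := by
    intro y hy
    rw [hE, ← sub_eq_zero, ← norm_eq_zero]
    have h1 : ‖T y‖ ≤ ‖y‖ := by
      refine (v.adjoint.le_opNorm (v y)).trans ?_
      rw [LinearIsometryEquiv.norm_map, ← hy]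
      exact mul_le_of_le_one_left (norm_nonneg _) hvle
    have h2 : RCLike.re (inner 𝕜 (T y) y) = ‖y‖ ^ 2 := by
      rw [hinner, inner_self_eq_norm_sq, hy]
    have h3 := norm_sub_sq (𝕜 := 𝕜) (T y) y
    rw [h2] at h3
    have h4 := pow_le_pow_left₀ (norm_nonneg _) h1 2
    have h5 : ‖T y - y‖ ^ 2 ≤ 0 := by linarith
    exact pow_eq_zero_iff (two_ne_zero) |>.1 (le_antisymm h5 (by positivity))
  have hiso : ∀ y ∈ E, ‖v y‖ ^ 2 = ‖y‖ ^ 2 := fun y hy => by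
    rw [← inner_self_eq_norm_sq (𝕜 := 𝕜), ← hinner, hE.1 hy, inner_self_eq_norm_sq]
  obtain ⟨δ, hδ, hδ1, hcontr⟩ := exists_norm_sq_le_of_forall_norm_lt (v ∘L Eᗮ.subtypeL) (by
    rintro ⟨y, hy⟩ hy0
    refine lt_of_le_of_ne (hv y) fun h => hy0 ?_
    have h0 : inner 𝕜 y y = 0 := Submodule.inner_right_of_mem_orthogonal (hmem y h) hy
    exact Subtype.ext (inner_self_eq_zero.1 h0))
  have hdecomp : ∀ y, y - E.starProjection y ∈ Eᗮ := fun y =>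
    E.sub_starProjection_mem_orthogonal y
  have hsq : ∀ y, ‖y‖ ^ 2 = ‖E.starProjection y‖ ^ 2 + ‖y - E.starProjection y‖ ^ 2 := fun y => by
    have h0 : inner 𝕜 (E.starProjection y) (y - E.starProjection y) = 0 :=
      Submodule.inner_right_of_mem_orthogonal (E.starProjection_apply_mem y) (hdecomp y)
    have := norm_add_sq (𝕜 := 𝕜) (E.starProjection y) (y - E.starProjection y)
    rw [h0] at this
    simpa using this
  have hvsq : ∀ y, ‖v y‖ ^ 2 = ‖E.starProjection y‖ ^ 2 + ‖v (y - E.starProjection y)‖ ^ 2 :=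
    fun y => by
      have h0 : inner 𝕜 (v (E.starProjection y)) (v (y - E.starProjection y)) = 0 := by
        rw [← hinner, hE.1 (E.starProjection_apply_mem y)]
        exact Submodule.inner_right_of_mem_orthogonal (E.starProjection_apply_mem y) (hdecomp y)
      have := norm_add_sq (𝕜 := 𝕜) (v (E.starProjection y)) (v (y - E.starProjection y))
      rw [h0, hiso _ (E.starProjection_apply_mem y), ← map_add] at this
      simpa using this
  refine ⟨E.starProjection, δ, hδ, hδ1, ?_, E.starProjection_norm_le, ?_, fun y => ?_, fun y => ?_⟩
  · exact E.isIdempotentElem_starProjection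
  -- `v` is isometric on `E`, so the dimension of `E` is at most that of `G`.
  · have hinj : Function.Injective ((v : H →ₗ[𝕜] G) ∘ₗ E.subtype) := by
      rw [injective_iff_map_eq_zero]
      rintro ⟨y, hy⟩ h0
      have h1 : v y = 0 := h0
      have := hiso y hy
      rw [h1] at this
      exact Subtype.ext (by simpa using this.symm)
    have hrange : LinearMap.range (E.starProjection : H →ₗ[𝕜] H) = E := E.range_starProjection
    rw [LinearMap.rank, hrange, ← Module.finrank_eq_rank]
    exact_mod_cast LinearMap.finrank_le_finrank_of_injective hinj
  · refine le_of_sq_le_sq ?_ (norm_nonneg _)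
    rw [hvsq y]
    exact le_add_of_nonneg_right (by positivity)
  · have h1 : ‖v (y - E.starProjection y)‖ ^ 2 ≤ (1 - δ) * ‖y - E.starProjection y‖ ^ 2 :=
      hcontr ⟨_, hdecomp y⟩
    rw [hvsq y]
    nlinarith [hsq y]

/-- A finite-dimensional Hilbert space of dimension at most `k` embeds isometrically in `ℓ₂ᵏ`. -/
theorem exists_linearIsometry_euclideanSpace {k : ℕ} (hk : Module.finrank 𝕜 H ≤ k) :
    Nonempty (H →ₗᵢ[𝕜] EuclideanSpace 𝕜 (Fin k)) := by
  let b := stdOrthonormalBasis 𝕜 H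
  let c := EuclideanSpace.basisFun (Fin k) 𝕜
  let f : H →ₗ[𝕜] EuclideanSpace 𝕜 (Fin k) :=
    b.toBasis.constr 𝕜 fun i => c (Fin.castLE hk i)
  refine ⟨f.isometryOfOrthonormal (v := b.toBasis) (by simp) ?_⟩
  have : f ∘ b.toBasis = c ∘ Fin.castLE hk := by
    ext1 i
    exact b.toBasis.constr_basis 𝕜 _ i
  rw [this]
  exact c.orthonormal.comp _ (Fin.castLE_injective hk)

end Contraction

/-! ### Basic properties of the 2-summing norm -/

section TwoSumming

variable {𝕜 E F G : Type*} [RCLike 𝕜]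
  [NormedAddCommGroup E] [NormedSpace 𝕜 E] [NormedAddCommGroup F] [NormedSpace 𝕜 F]
  [NormedAddCommGroup G] [NormedSpace 𝕜 G]

theorem twoSummingNorm_congr {T : E →L[𝕜] F} {S : E →L[𝕜] G} (h : ∀ x, ‖T x‖ = ‖S x‖) :
    twoSummingNorm T = twoSummingNorm S := by
  have h' : ∀ x, ‖T x‖ₑ = ‖S x‖ₑ := fun x => by rw [← ofReal_norm, h, ofReal_norm]
  simp only [twoSummingNorm, h']

theorem rpow_sum_enorm_sq_le_ofReal_iff {ι : Type*} [Fintype ι] (a : ι → F) {C : ℝ} (hC : 0 ≤ C) :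
    (∑ i, ‖a i‖ₑ ^ 2) ^ (1 / 2 : ℝ) ≤ ENNReal.ofReal C ↔ ∑ i, ‖a i‖ ^ 2 ≤ C ^ 2 := by
  have h1 : ∑ i, ‖a i‖ₑ ^ 2 = ENNReal.ofReal (∑ i, ‖a i‖ ^ 2) := by
    rw [ENNReal.ofReal_sum_of_nonneg fun i _ => by positivity]
    exact Finset.sum_congr rfl fun i _ => by
      rw [ENNReal.ofReal_pow (norm_nonneg _), ofReal_norm]
  rw [one_div, ENNReal.rpow_inv_le_iff two_pos, h1, ENNReal.ofReal_rpow_of_nonneg hC two_pos.le,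
    ENNReal.ofReal_le_ofReal_iff (by positivity), Real.rpow_two]

theorem twoSummingNorm_le_ofReal_iff_of_norm_eq_one (T : E →L[𝕜] F) {C : ℝ} (hC : 0 ≤ C) :
    twoSummingNorm T ≤ ENNReal.ofReal C ↔
      ∀ (m : ℕ) (U : EuclideanSpace 𝕜 (Fin m) →L[𝕜] E), ‖U‖ = 1 →
        ∑ i, ‖T (U (EuclideanSpace.single i 1))‖ ^ 2 ≤ C ^ 2 := by
  simp only [twoSummingNorm, iSup_le_iff, rpow_sum_enorm_sq_le_ofReal_iff _ hC]

theorem twoSummingNorm_le_ofReal_iff (T : E →L[𝕜] F) {C : ℝ} (hC : 0 ≤ C) :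
    twoSummingNorm T ≤ ENNReal.ofReal C ↔
      ∀ (m : ℕ) (U : EuclideanSpace 𝕜 (Fin m) →L[𝕜] E),
        ∑ i, ‖T (U (EuclideanSpace.single i 1))‖ ^ 2 ≤ C ^ 2 * ‖U‖ ^ 2 := by
  rw [twoSummingNorm_le_ofReal_iff_of_norm_eq_one T hC]
  refine ⟨fun h m U => ?_, fun h m U hU => by simpa [hU] using h m U⟩
  rcases eq_or_ne U 0 with rfl | hU
  · simp
  have hpos : 0 < ‖U‖ := norm_pos_iff.2 hU
  have := h m (((‖U‖⁻¹ : ℝ) : 𝕜) • U) (by simp [norm_smul, inv_mul_cancel₀ hpos.ne'])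
  simp only [smul_apply, map_smul, norm_smul, RCLike.norm_ofReal, abs_inv,
    abs_norm, mul_pow, ← Finset.mul_sum, inv_pow] at this
  rwa [inv_mul_le_iff₀ (by positivity), mul_comm] at this

/-- By Riesz representation, the sum is the squared norm of the vector representing `φ`. -/
theorem sum_norm_sq_apply_single_le (m : ℕ) (φ : EuclideanSpace 𝕜 (Fin m) →L[𝕜] 𝕜) :
    ∑ i, ‖φ (EuclideanSpace.single i 1)‖ ^ 2 ≤ ‖φ‖ ^ 2 := by
  set z := (InnerProductSpace.toDual 𝕜 (EuclideanSpace 𝕜 (Fin m))).symm φ with hz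
  have h1 : ‖z‖ = ‖φ‖ := by rw [hz, LinearIsometryEquiv.norm_map]
  rw [← h1, EuclideanSpace.norm_sq_eq]
  refine le_of_eq (Finset.sum_congr rfl fun i _ => ?_)
  rw [← InnerProductSpace.toDual_symm_apply (x := EuclideanSpace.single i 1) (y := φ), ← hz,
    EuclideanSpace.inner_single_right]
  simp

/-- Operators into `ℓ₂ᵏ` are `2`-summing. -/
theorem twoSummingNorm_lt_top {k : ℕ} (u : E →L[𝕜] EuclideanSpace 𝕜 (Fin k)) :
    twoSummingNorm u < ∞ := by
  -- Each of the `k` coordinates of `u` is a functional of norm at most `‖u‖`, whence the factor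
  -- `√k`.
  refine lt_of_le_of_lt ((twoSummingNorm_le_ofReal_iff u
    (C := √(k : ℝ) * ‖u‖) (by positivity)).2 fun m U => ?_) ENNReal.ofReal_lt_top
  simp only [EuclideanSpace.norm_sq_eq]
  rw [Finset.sum_comm]
  have hj : ∀ j : Fin k, ∑ i, ‖u (U (EuclideanSpace.single i 1)) j‖ ^ 2 ≤ (‖u‖ * ‖U‖) ^ 2 := by
    intro j
    refine (sum_norm_sq_apply_single_le m ((EuclideanSpace.proj j).comp (u.comp U))).trans ?_
    refine pow_le_pow_left₀ (norm_nonneg _) (ContinuousLinearMap.opNorm_le_bound _ (by positivity)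
      fun a => ?_) 2
    refine (PiLp.norm_apply_le (u (U a)) j).trans ((u.le_opNorm _).trans ?_)
    rw [mul_assoc]
    gcongr
    exact U.le_opNorm a
  refine (Finset.sum_le_sum fun j _ => hj j).trans (le_of_eq ?_)
  rw [Finset.sum_const, Finset.card_univ, Fintype.card_fin, nsmul_eq_mul, mul_pow, mul_pow,
    Real.sq_sqrt (Nat.cast_nonneg k)]
  ring

theorem twoSummingNorm_eq_zero_iff (T : E →L[𝕜] F) : twoSummingNorm T = 0 ↔ T = 0 := by
  rw [← nonpos_iff_eq_zero, ← ENNReal.ofReal_zero, twoSummingNorm_le_ofReal_iff T le_rfl]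
  refine ⟨fun h => ?_, by rintro rfl; simp⟩
  ext x
  -- The case `m = 1`, with `U` sending the unit vector to `x`, already detects `T x`.
  have := h 1 ((EuclideanSpace.proj (0 : Fin 1)).smulRight x)
  simp only [Finset.univ_unique, Finset.sum_singleton] at this
  simpa using this

end TwoSumming

/-! ### Operators from ℓ₂ᵐ into subspaces of C(K) -/

section SubspaceCK

variable {𝕜 K : Type*} [RCLike 𝕜] [TopologicalSpace K] [CompactSpace K]

/-- Evaluation at `t` after `U` is a functional of norm at most `‖U‖`. With the converse below,
`‖U‖²` is governed by the pointwise sums of squares. -/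
theorem sum_norm_sq_apply_single_eval_le {X : Submodule 𝕜 C(K, 𝕜)} {m : ℕ}
    (U : EuclideanSpace 𝕜 (Fin m) →L[𝕜] X) (t : K) :
    ∑ i, ‖(U (EuclideanSpace.single i 1) : C(K, 𝕜)) t‖ ^ 2 ≤ ‖U‖ ^ 2 := by
  refine (sum_norm_sq_apply_single_le m
    ((ContinuousMap.evalCLM 𝕜 t).comp (X.subtypeL.comp U))).trans ?_
  refine pow_le_pow_left₀ (norm_nonneg _) (ContinuousLinearMap.opNorm_le_bound _ (by positivity)
    fun a => ?_) 2
  exact ((U a : C(K, 𝕜)).norm_coe_le_norm t).trans (U.le_opNorm a)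

/-- A family `x` in a subspace of `C(K)` with `∑ i, |x i| ^ 2 ≤ C ^ 2` pointwise is the image of
the unit vectors under an operator of norm at most `C`. -/
theorem exists_apply_single_eq_of_sum_norm_sq_le {X : Submodule 𝕜 C(K, 𝕜)} {m : ℕ}
    (x : Fin m → X) {C : ℝ} (hC : 0 ≤ C) (h : ∀ t, ∑ i, ‖(x i : C(K, 𝕜)) t‖ ^ 2 ≤ C ^ 2) :
    ∃ U : EuclideanSpace 𝕜 (Fin m) →L[𝕜] X,
      (∀ i, U (EuclideanSpace.single i 1) = x i) ∧ ‖U‖ ≤ C := by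
  refine ⟨∑ i, (EuclideanSpace.proj i).smulRight (x i), fun i => ?_,
    ContinuousLinearMap.opNorm_le_bound _ hC fun a => ?_⟩
  · simp
  · refine (ContinuousMap.norm_le _ (by positivity)).2 fun t => ?_
    have h1 : ((((∑ i, (EuclideanSpace.proj i).smulRight (x i) :
        EuclideanSpace 𝕜 (Fin m) →L[𝕜] X) a : X) : C(K, 𝕜)) t) =
        ∑ i, a i * (x i : C(K, 𝕜)) t := by
      simp [ContinuousMap.sum_apply]
    refine (congrArg norm h1).trans_le ?_
    calc ‖∑ i, a i * (x i : C(K, 𝕜)) t‖ ≤ ∑ i, ‖a i‖ * ‖(x i : C(K, 𝕜)) t‖ :=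
          (norm_sum_le _ _).trans_eq (by simp)
      _ ≤ √(∑ i, ‖a i‖ ^ 2) * √(∑ i, ‖(x i : C(K, 𝕜)) t‖ ^ 2) :=
          Real.sum_mul_le_sqrt_mul_sqrt _ _ _
      _ ≤ ‖a‖ * C := by
          rw [EuclideanSpace.norm_eq]
          gcongr
          exact (Real.sqrt_le_left hC).2 (h t)
      _ = C * ‖a‖ := mul_comm _ _

end SubspaceCK

/-! ### Pietsch domination by Hahn–Banach separation -/

section Pietsch

variable {𝕜 K : Type*} [RCLike 𝕜] [TopologicalSpace K] [CompactSpace K]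
  [MeasurableSpace K] [BorelSpace K]

theorem norm_formalIdOn_sq (X : Submodule 𝕜 C(K, 𝕜)) (μ : Measure K) [IsFiniteMeasure μ] (x : X) :
    ‖formalIdOn X μ x‖ ^ 2 = ∫ t, ‖(x : C(K, 𝕜)) t‖ ^ 2 ∂μ := by
  have h0 : ‖formalIdOn X μ x‖ = ‖formalId (𝕜 := 𝕜) μ (x : C(K, 𝕜))‖ := rfl
  rw [h0, ← inner_self_eq_norm_sq (𝕜 := 𝕜), L2.inner_def]
  have h1 : ∫ t, inner 𝕜 (formalId (𝕜 := 𝕜) μ (x : C(K, 𝕜)) t)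
      (formalId (𝕜 := 𝕜) μ (x : C(K, 𝕜)) t) ∂μ =
      ∫ t, ((‖(x : C(K, 𝕜)) t‖ ^ 2 : ℝ) : 𝕜) ∂μ := by
    refine integral_congr_ae ?_
    filter_upwards [ContinuousMap.coeFn_toLp (p := 2) (𝕜 := 𝕜) μ (x : C(K, 𝕜))] with t ht
    rw [formalId, ht, inner_self_eq_norm_sq_to_K]
    norm_cast
  rw [h1, integral_ofReal, RCLike.ofReal_re]

theorem integrable_norm_sq (μ : Measure K) [IsFiniteMeasure μ] (f : C(K, 𝕜)) :
    Integrable (fun t => ‖f t‖ ^ 2) μ :=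
  (f.continuous.norm.pow 2).integrable_of_hasCompactSupport (HasCompactSupport.of_compactSpace _)

theorem sum_norm_formalIdOn_sq_le (X : Submodule 𝕜 C(K, 𝕜)) (μ : Measure K)
    [IsProbabilityMeasure μ] {m : ℕ} (U : EuclideanSpace 𝕜 (Fin m) →L[𝕜] X) :
    ∑ i, ‖formalIdOn X μ (U (EuclideanSpace.single i 1))‖ ^ 2 ≤ ‖U‖ ^ 2 := by
  simp only [norm_formalIdOn_sq]
  rw [← integral_finsetSum _ fun i _ => integrable_norm_sq μ _]
  calc _ ≤ ∫ _, ‖U‖ ^ 2 ∂μ :=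
        integral_mono (integrable_finsetSum _ fun i _ => integrable_norm_sq μ _)
          (integrable_const _) fun t => sum_norm_sq_apply_single_eval_le U t
    _ = ‖U‖ ^ 2 := by simp

/-- A functional on `C(K, ℝ)` that is positive on strictly positive functions is, up to a positive
factor, integration against a regular probability measure. -/
theorem exists_probabilityMeasure_integral_eq [T2Space K] [Nonempty K] (L : C(K, ℝ) →L[ℝ] ℝ)
    (hL : ∀ g : C(K, ℝ), (∀ t, 0 < g t) → 0 < L g) :
    ∃ (μ : Measure K) (_ : IsProbabilityMeasure μ), μ.Regular ∧
      ∀ g : C(K, ℝ), L g = L 1 * ∫ t, g t ∂μ := by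
  have h1 : 0 < L 1 := hL 1 fun t => by simp
  have hnonneg : ∀ g : C(K, ℝ), (∀ t, 0 ≤ g t) → 0 ≤ L g := by
    intro g hg
    by_contra! hneg
    -- Adding this constant makes `g` strictly positive while `L` takes the value `L g / 2 < 0`.
    have hpos : 0 < -L g / (2 * L 1) := by apply div_pos <;> linarith
    have := hL (g + (-L g / (2 * L 1)) • (1 : C(K, ℝ))) fun t => by
      have := hg t
      simp only [ContinuousMap.add_apply, ContinuousMap.smul_apply, ContinuousMap.one_apply,
        smul_eq_mul, mul_one]
      linarith
    rw [map_add, map_smul, smul_eq_mul] at this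
    have h2 : -L g / (2 * L 1) * L 1 = -L g / 2 := by field_simp
    linarith
  let Λ : CompactlySupportedContinuousMap K ℝ →ₚ[ℝ] ℝ := PositiveLinearMap.mk₀
    { toFun := fun f => (L 1)⁻¹ * L f.toContinuousMap
      map_add' := fun f g => by
        rw [← mul_add, ← map_add]
        rfl
      map_smul' := fun c f => by
        rw [RingHom.id_apply, smul_eq_mul, mul_left_comm, ← smul_eq_mul c, ← map_smul]
        rfl }
    fun f hf => mul_nonneg (by positivity) (hnonneg _ hf)
  have hint : ∀ g : C(K, ℝ), ∫ t, g t ∂(RealRMK.rieszMeasure Λ) = (L 1)⁻¹ * L g := fun g =>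
    RealRMK.integral_rieszMeasure Λ ⟨g, HasCompactSupport.of_compactSpace _⟩
  refine ⟨RealRMK.rieszMeasure Λ, ⟨?_⟩, inferInstance, fun g => ?_⟩
  · have := hint 1
    simp only [ContinuousMap.one_apply, integral_const, smul_eq_mul, mul_one,
      inv_mul_cancel₀ h1.ne'] at this
    exact (ENNReal.toReal_eq_one_iff _).1 this
  · rw [hint, mul_inv_cancel_left₀ h1.ne']

/-- Pietsch's domination theorem for `2`-summing operators on subspaces of `C(K)`. -/
theorem exists_probabilityMeasure_norm_le [T2Space K] [Nonempty K] {X : Submodule 𝕜 C(K, 𝕜)}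
    {F : Type*} [NormedAddCommGroup F] [NormedSpace 𝕜 F] (w : X →L[𝕜] F)
    (hw : ∀ (m : ℕ) (U : EuclideanSpace 𝕜 (Fin m) →L[𝕜] X),
      ∑ i, ‖w (U (EuclideanSpace.single i 1))‖ ^ 2 ≤ ‖U‖ ^ 2) :
    ∃ (μ : Measure K) (_ : IsProbabilityMeasure μ), μ.Regular ∧
      ∀ x, ‖w x‖ ≤ ‖formalIdOn X μ x‖ := by
  let A : Set C(K, ℝ) := {g | ∀ t, 0 < g t}
  -- `S` is convex because families scaled by square roots of the weights can be concatenated. It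
  -- misses `A` because `hw` bounds `∑ ‖w (x i)‖²` by the maximum of `∑ |x i|²`.
  let S : Set C(K, ℝ) := {g | ∃ (m : ℕ) (x : Fin m → X),
    ∀ t, g t = ∑ i, ‖w (x i)‖ ^ 2 - ∑ i, ‖(x i : C(K, 𝕜)) t‖ ^ 2}
  have hAc : Convex ℝ A := by
    intro f hf g hg a b ha hb hab t
    simp only [ContinuousMap.add_apply, ContinuousMap.smul_apply, smul_eq_mul]
    rcases ha.eq_or_lt with rfl | ha
    · have : b = 1 := by linarith
      simpa [this] using hg t
    · exact add_pos_of_pos_of_nonneg (mul_pos ha (hf t)) (mul_nonneg hb (hg t).le)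
  have hAo : IsOpen A := by
    have := ContinuousMap.isOpen_setOfPred_mapsTo (X := K) (Y := ℝ) isCompact_univ (isOpen_Ioi (a := 0))
    convert this using 1
    ext g
    simp [A, Set.MapsTo]
  have hSc : Convex ℝ S := by
    rintro f ⟨m, x, hf⟩ g ⟨l, y, hg⟩ a b ha hb -
    refine ⟨m + l, Fin.append (fun i => ((√a : ℝ) : 𝕜) • x i) (fun i => ((√b : ℝ) : 𝕜) • y i),
      fun t => ?_⟩
    simp only [ContinuousMap.add_apply, ContinuousMap.smul_apply, smul_eq_mul, hf t, hg t,
      Fin.sum_univ_add, Fin.append_left, Fin.append_right, map_smul, norm_smul, Submodule.coe_smul,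
      norm_mul, RCLike.norm_ofReal, abs_of_nonneg (Real.sqrt_nonneg _), mul_pow, Real.sq_sqrt ha,
      Real.sq_sqrt hb, ← Finset.mul_sum]
    ring
  have hdisj : Disjoint A S := by
    rw [Set.disjoint_left]
    rintro g hg ⟨m, x, hx⟩
    let q : K → ℝ := fun t => ∑ i, ‖(x i : C(K, 𝕜)) t‖ ^ 2
    have hq : Continuous q := by fun_prop
    obtain ⟨t₀, ht₀⟩ :=
      hq.exists_forall_ge_of_hasCompactSupport (HasCompactSupport.of_compactSpace _)
    have hq0 : 0 ≤ q t₀ := Finset.sum_nonneg fun i _ => by positivity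
    obtain ⟨U, hU, hUn⟩ := exists_apply_single_eq_of_sum_norm_sq_le x (Real.sqrt_nonneg (q t₀))
      fun t => by rw [Real.sq_sqrt hq0]; exact ht₀ t
    have h1 := hw m U
    simp only [hU] at h1
    have h2 : ‖U‖ ^ 2 ≤ q t₀ := (Real.le_sqrt (norm_nonneg U) hq0).1 hUn
    have h3 : 0 < ∑ i, ‖w (x i)‖ ^ 2 - q t₀ := (hx t₀) ▸ hg t₀
    linarith
  obtain ⟨f, s, hfA, hfS⟩ := geometric_hahn_banach_open hAc hAo hSc hdisj
  have hs0 : s ≤ 0 := by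
    simpa using hfS 0 ⟨0, Fin.elim0, fun t => by simp⟩
  -- Small positive constants lie in `A` and `f` is arbitrarily close to `0` on them, so `s` cannot
  -- be negative.
  have hs : 0 ≤ s := by
    by_contra! hneg
    have hA : ∀ ε : ℝ, 0 < ε → ε * f 1 < s := fun ε hε => by
      simpa using hfA (ε • 1) fun t => by simpa using hε
    have h1 := hA 1 one_pos
    have h2 := hA (s / (2 * f 1)) (div_pos_of_neg_of_neg hneg (by linarith))
    have h3 : s / (2 * f 1) * f 1 = s / 2 := by
      have : f 1 ≠ 0 := by linarith
      field_simp
    linarith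
  have hneg : ∀ g : C(K, ℝ), (∀ t, 0 < g t) → 0 < (-f) g := fun g hg => by
    have := hfA g hg
    rw [neg_apply]
    linarith
  obtain ⟨μ, hμ, hreg, hint⟩ := exists_probabilityMeasure_integral_eq (-f) hneg
  refine ⟨μ, hμ, hreg, fun x => le_of_sq_le_sq ?_ (norm_nonneg _)⟩
  rw [norm_formalIdOn_sq]
  let g : C(K, ℝ) := ⟨fun t => ‖w x‖ ^ 2 - ‖(x : C(K, 𝕜)) t‖ ^ 2, by fun_prop⟩
  -- One-element families give the domination inequality.
  have hg : 0 ≤ f g := hs.trans (hfS g ⟨1, fun _ => x, fun t => by simp [g]⟩)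
  have h1 : (0 : ℝ) < (-f) 1 := hneg 1 fun t => by simp
  have h2 : (-f) 1 * ∫ t, g t ∂μ ≤ 0 := by
    rw [← hint, neg_apply]
    linarith
  have h3 : ∫ t, g t ∂μ = ‖w x‖ ^ 2 - ∫ t, ‖(x : C(K, 𝕜)) t‖ ^ 2 ∂μ := by
    have := integral_sub (integrable_const (μ := μ) (‖w x‖ ^ 2))
      (integrable_norm_sq μ (x : C(K, 𝕜)))
    simpa [g] using this
  rw [h3] at h2
  have := nonpos_of_mul_nonpos_right h2 h1
  linarith

end Pietsch

/-! ### Replacing a contraction by a projection -/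

theorem one_le_norm_of_comp_self_eq {𝕜 E : Type*} [RCLike 𝕜] [NormedAddCommGroup E]
    [NormedSpace 𝕜 E] {P : E →L[𝕜] E} (hPP : P ∘L P = P) (hP : P ≠ 0) : 1 ≤ ‖P‖ := by
  have h := P.opNorm_comp_le P
  rw [hPP] at h
  exact le_of_mul_le_mul_right ((one_mul _).trans_le h) (norm_pos_iff.2 hP)

section Hilbert

variable {𝕜 E H : Type*} [RCLike 𝕜] [NormedAddCommGroup E] [NormedSpace 𝕜 E]
  [NormedAddCommGroup H] [InnerProductSpace 𝕜 H] {I : E →L[𝕜] H}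

theorem twoSummingNorm_comp_le_one
    (hI : ∀ (m : ℕ) (U : EuclideanSpace 𝕜 (Fin m) →L[𝕜] E),
      ∑ i, ‖I (U (EuclideanSpace.single i 1))‖ ^ 2 ≤ ‖U‖ ^ 2)
    {P : H →L[𝕜] H} (hP : ‖P‖ ≤ 1) : twoSummingNorm (P ∘L I) ≤ 1 := by
  rw [← ENNReal.ofReal_one, twoSummingNorm_le_ofReal_iff _ zero_le_one]
  intro m U
  rw [one_pow, one_mul]
  refine le_trans (Finset.sum_le_sum fun i _ => ?_) (hI m U)
  exact pow_le_pow_left₀ (norm_nonneg _)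
    ((P.le_opNorm _).trans (mul_le_of_le_one_left (norm_nonneg _) hP)) 2

/-- If `u`, normalized by its `2`-summing norm `p`, factors through a `2`-summing contraction `I`
into a Hilbert space by a contraction `v`, then `v` can be replaced by a projection. -/
theorem exists_projection_twoSummingNorm_comp_eq_one [FiniteDimensional 𝕜 H]
    (hI : ∀ (m : ℕ) (U : EuclideanSpace 𝕜 (Fin m) →L[𝕜] E),
      ∑ i, ‖I (U (EuclideanSpace.single i 1))‖ ^ 2 ≤ ‖U‖ ^ 2)
    {k : ℕ} {u : E →L[𝕜] EuclideanSpace 𝕜 (Fin k)} (hu : u ≠ 0) {p : ℝ}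
    (hpu : twoSummingNorm u = ENNReal.ofReal p) (hp0 : 0 < p)
    {v : H →L[𝕜] EuclideanSpace 𝕜 (Fin k)} (hv : ∀ y, ‖v y‖ ≤ ‖y‖)
    (hvu : ∀ x, ‖v (I x)‖ = p⁻¹ * ‖u x‖) :
    ∃ P : H →L[𝕜] H, P ∘L P = P ∧ ‖P‖ = 1 ∧
      LinearMap.rank (P : H →ₗ[𝕜] H) ≤ (k : Cardinal) ∧
      twoSummingNorm (P ∘L I) = 1 ∧ twoSummingNorm u / ‖u‖ₑ ≤ 1 / ‖P ∘L I‖ₑ := by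
  obtain ⟨P, δ, hδ, hδ1, hPP, hPn, hrank, hPv, hvP⟩ := exists_projection_of_contraction v hv
  have hle := twoSummingNorm_comp_le_one hI hPn
  have hone : twoSummingNorm (P ∘L I) = 1 := by
    refine le_antisymm hle ?_
    set q : ℝ := (twoSummingNorm (P ∘L I)).toReal with hq
    have hqP : twoSummingNorm (P ∘L I) = ENNReal.ofReal q :=
      (ENNReal.ofReal_toReal (hle.trans_lt ENNReal.one_lt_top).ne).symm
    have hq0 : 0 ≤ q := ENNReal.toReal_nonneg
    have hU : ∀ (m : ℕ) (U : EuclideanSpace 𝕜 (Fin m) →L[𝕜] E), ‖U‖ = 1 →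
        ∑ i, ‖u (U (EuclideanSpace.single i 1))‖ ^ 2 ≤ p ^ 2 * (1 - δ + δ * q ^ 2) := by
      intro m U hU1
      have h1 := hI m U
      have h2 := (twoSummingNorm_le_ofReal_iff_of_norm_eq_one _ hq0).1 hqP.le m U hU1
      have h3 : ∑ i, ‖v (I (U (EuclideanSpace.single i 1)))‖ ^ 2 ≤
          (1 - δ) * ∑ i, ‖I (U (EuclideanSpace.single i 1))‖ ^ 2 +
          δ * ∑ i, ‖(P ∘L I) (U (EuclideanSpace.single i 1))‖ ^ 2 := by
        rw [Finset.mul_sum, Finset.mul_sum, ← Finset.sum_add_distrib]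
        refine Finset.sum_le_sum fun i _ => ?_
        exact hvP _
      simp only [hvu, mul_pow, ← Finset.mul_sum] at h3
      rw [inv_pow, inv_mul_le_iff₀ (by positivity)] at h3
      rw [hU1, one_pow] at h1
      refine h3.trans (mul_le_mul_of_nonneg_left ?_ (by positivity))
      exact add_le_add (mul_le_of_le_one_right (by linarith) h1)
        (mul_le_mul_of_nonneg_left h2 hδ.le)
    have hnn : 0 ≤ 1 - δ + δ * q ^ 2 := add_nonneg (by linarith) (by positivity)
    have h1 := (twoSummingNorm_le_ofReal_iff_of_norm_eq_one u
      (C := p * √(1 - δ + δ * q ^ 2)) (by positivity)).2 fun m U hU1 => by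
        rw [mul_pow, Real.sq_sqrt hnn]
        exact hU m U hU1
    rw [hpu, ENNReal.ofReal_le_ofReal_iff (by positivity)] at h1
    -- Otherwise `p` would not be the least 2-summing constant of `u`.
    have h2 : 1 ≤ √(1 - δ + δ * q ^ 2) := by
      by_contra! hlt
      nlinarith
    rw [Real.one_le_sqrt] at h2
    have h3 : 1 ≤ q ^ 2 := by
      by_contra! hlt
      nlinarith
    rw [hqP, ← ENNReal.ofReal_one]
    exact ENNReal.ofReal_le_ofReal ((one_le_sq_iff₀ hq0).1 h3)
  have hP0 : P ≠ 0 := by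
    rintro rfl
    rw [(twoSummingNorm_eq_zero_iff _).2 (ContinuousLinearMap.zero_comp _)] at hone
    exact zero_ne_one hone
  have hP1 : ‖P‖ = 1 := le_antisymm hPn (one_le_norm_of_comp_self_eq hPP hP0)
  refine ⟨P, hPP, hP1, by simpa using hrank, hone, ?_⟩
  have hnorm : ‖P ∘L I‖ ≤ p⁻¹ * ‖u‖ := by
    refine ContinuousLinearMap.opNorm_le_bound _ (by positivity) fun x => ?_
    calc ‖P (I x)‖ ≤ ‖v (I x)‖ := hPv _
      _ = p⁻¹ * ‖u x‖ := hvu x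
      _ ≤ p⁻¹ * ‖u‖ * ‖x‖ := by
        rw [mul_assoc]
        gcongr
        exact u.le_opNorm x
  have hu0 : 0 < ‖u‖ := norm_pos_iff.2 hu
  rw [hpu, one_div, ENNReal.le_inv_iff_le_inv, ← ofReal_norm, ← ofReal_norm,
    ← ENNReal.ofReal_div_of_pos hu0, ← ENNReal.ofReal_inv_of_pos (by positivity), inv_div,
    div_eq_inv_mul]
  exact ENNReal.ofReal_le_ofReal hnorm

end Hilbert

/-! ### Passing between operators and projections -/

section Extremal

variable {𝕜 K : Type*} [RCLike 𝕜] [TopologicalSpace K] [CompactSpace K]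
  [MeasurableSpace K] [BorelSpace K]

/-- An operator dominated by the canonical map factors through it. -/
theorem exists_comp_formalIdOn_eq (X : Submodule 𝕜 C(K, 𝕜)) [FiniteDimensional 𝕜 X]
    (μ : Measure K) [IsFiniteMeasure μ] {F : Type*} [NormedAddCommGroup F] [NormedSpace 𝕜 F]
    (w : X →L[𝕜] F) (hw : ∀ x, ‖w x‖ ≤ ‖formalIdOn X μ x‖) :
    ∃ v : imageL2 X μ →L[𝕜] F, (∀ x, v (formalIdOn X μ x) = w x) ∧ ∀ y, ‖v y‖ ≤ ‖y‖ := by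
  have hsurj : Function.Surjective (formalIdOn X μ) := by
    rintro ⟨_, x, hx, rfl⟩
    exact ⟨⟨x, hx⟩, rfl⟩
  -- Any linear section will do: by domination, `w` vanishes on the kernel of the canonical map.
  obtain ⟨s, hs⟩ := (formalIdOn X μ : X →ₗ[𝕜] imageL2 X μ).exists_rightInverse_of_surjective
    (LinearMap.range_eq_top.2 hsurj)
  have hv : ∀ x, w (s (formalIdOn X μ x)) = w x := fun x => by
    have h1 : formalIdOn X μ (s (formalIdOn X μ x)) = formalIdOn X μ x :=
      LinearMap.congr_fun hs (formalIdOn X μ x)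
    have h2 := hw (s (formalIdOn X μ x) - x)
    rw [map_sub (formalIdOn X μ), h1, sub_self, norm_zero, norm_le_zero_iff, map_sub,
      sub_eq_zero] at h2
    exact h2
  refine ⟨LinearMap.toContinuousLinearMap ((w : X →ₗ[𝕜] F) ∘ₗ s), hv, fun y => ?_⟩
  obtain ⟨x, rfl⟩ := hsurj y
  exact (congrArg norm (hv x)).trans_le (hw x)

theorem exists_projection_twoSummingNorm_div_le [T2Space K] {X : Submodule 𝕜 C(K, 𝕜)}
    [FiniteDimensional 𝕜 X] {k : ℕ} {u : X →L[𝕜] EuclideanSpace 𝕜 (Fin k)} (hu : u ≠ 0) :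
    ∃ (μ : Measure K) (_ : IsProbabilityMeasure μ) (P : imageL2 X μ →L[𝕜] imageL2 X μ),
      μ.Regular ∧ P ∘L P = P ∧ ‖P‖ = 1 ∧
      LinearMap.rank (P : imageL2 X μ →ₗ[𝕜] imageL2 X μ) ≤ (k : Cardinal) ∧
      twoSummingNorm (P ∘L formalIdOn X μ) = 1 ∧
      twoSummingNorm u / ‖u‖ₑ ≤ 1 / ‖P ∘L formalIdOn X μ‖ₑ := by
  -- An empty `K` carries no probability measure, but there C(K) = 0 forces `u = 0`.
  have hK : Nonempty K := by
    by_contra! hempty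
    exact hu (ContinuousLinearMap.ext fun x => by
      rw [show x = 0 from Subtype.ext (ContinuousMap.ext fun t => (hempty.false t).elim)]
      simp)
  set p : ℝ := (twoSummingNorm u).toReal with hp
  have hpu : twoSummingNorm u = ENNReal.ofReal p :=
    (ENNReal.ofReal_toReal (twoSummingNorm_lt_top u).ne).symm
  have hp0 : 0 < p :=
    ENNReal.toReal_pos ((twoSummingNorm_eq_zero_iff u).not.2 hu) (twoSummingNorm_lt_top u).ne
  set w : X →L[𝕜] EuclideanSpace 𝕜 (Fin k) := ((p⁻¹ : ℝ) : 𝕜) • u with hw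
  have hwu : ∀ x, ‖w x‖ = p⁻¹ * ‖u x‖ := fun x => by
    simp [hw, norm_smul, abs_of_pos hp0]
  obtain ⟨μ, hμ, hreg, hdom⟩ := exists_probabilityMeasure_norm_le w fun m U => by
    simp only [hwu, mul_pow, ← Finset.mul_sum]
    rw [inv_pow, inv_mul_le_iff₀ (by positivity)]
    exact (twoSummingNorm_le_ofReal_iff u hp0.le).1 hpu.le m U
  obtain ⟨v, hvw, hv⟩ := exists_comp_formalIdOn_eq X μ w hdom
  obtain ⟨P, hPP, hP1, hrank, hone, hle⟩ := exists_projection_twoSummingNorm_comp_eq_one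
    (I := formalIdOn X μ) (fun m U => sum_norm_formalIdOn_sq_le X μ U) hu hpu hp0 hv
    (fun x => by rw [hvw, hwu])
  exact ⟨μ, hμ, P, hreg, hPP, hP1, hrank, hone, hle⟩

theorem exists_twoSummingNorm_eq_of_rank_le {X : Submodule 𝕜 C(K, 𝕜)}
    [FiniteDimensional 𝕜 X] {k : ℕ} (μ : Measure K) [IsProbabilityMeasure μ]
    (P : imageL2 X μ →L[𝕜] imageL2 X μ)
    (hrank : LinearMap.rank (P : imageL2 X μ →ₗ[𝕜] imageL2 X μ) ≤ (k : Cardinal)) :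
    ∃ u : X →L[𝕜] EuclideanSpace 𝕜 (Fin k),
      twoSummingNorm u = twoSummingNorm (P ∘L formalIdOn X μ) ∧
      ‖u‖ₑ = ‖P ∘L formalIdOn X μ‖ₑ := by
  let R := LinearMap.range (P : imageL2 X μ →ₗ[𝕜] imageL2 X μ)
  have hR : Module.finrank 𝕜 R ≤ k := by
    rw [LinearMap.rank, ← Module.finrank_eq_rank] at hrank
    exact_mod_cast hrank
  obtain ⟨J⟩ := exists_linearIsometry_euclideanSpace (𝕜 := 𝕜) (H := R) hR
  let u : X →L[𝕜] EuclideanSpace 𝕜 (Fin k) := J.toContinuousLinearMap ∘L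
    (P ∘L formalIdOn X μ).codRestrict R fun x => LinearMap.mem_range_self _ _
  have hu : ∀ x, ‖u x‖ = ‖(P ∘L formalIdOn X μ) x‖ := fun x => J.norm_map _
  refine ⟨u, twoSummingNorm_congr hu, ?_⟩
  rw [← ofReal_norm, ← ofReal_norm]
  congr 1
  refine le_antisymm (u.opNorm_le_bound (norm_nonneg _) fun x => ?_)
    (ContinuousLinearMap.opNorm_le_bound _ (norm_nonneg _) fun x => ?_)
  · rw [hu]
    exact ContinuousLinearMap.le_opNorm _ x
  · rw [← hu]
    exact u.le_opNorm x

end Extremal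

/-! ### Equality of the two suprema -/

theorem proposition2p6 {𝕜 K : Type*} [RCLike 𝕜] [TopologicalSpace K] [CompactSpace K] [T2Space K]
    [MeasurableSpace K] [BorelSpace K]
    (X : Submodule 𝕜 C(K, 𝕜)) [FiniteDimensional 𝕜 X] (n k : ℕ)
    (hn : Module.finrank 𝕜 X = n) (hk : k ≤ n) :
    sSup {r : ℝ≥0∞ | ∃ u : X →L[𝕜] EuclideanSpace 𝕜 (Fin k), r = twoSummingNorm u / ‖u‖ₑ} =
      sSup {r : ℝ≥0∞ | ∃ (μ : Measure K) (_ : IsProbabilityMeasure μ)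
        (P : imageL2 X μ →L[𝕜] imageL2 X μ),
          μ.Regular ∧ P ∘L P = P ∧ ‖P‖ = 1 ∧
          LinearMap.rank (P : imageL2 X μ →ₗ[𝕜] imageL2 X μ) ≤ (k : Cardinal) ∧
          twoSummingNorm (P ∘L formalIdOn X μ) = 1 ∧
          r = 1 / ‖P ∘L formalIdOn X μ‖ₑ} := by
  apply le_antisymm
  · refine sSup_le ?_
    rintro r ⟨u, rfl⟩
    rcases eq_or_ne u 0 with rfl | hu
    -- In `ℝ≥0∞` the quotient `0 / 0` is `0`, matching the convention for `u = 0`.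
    · simp [(twoSummingNorm_eq_zero_iff (0 : X →L[𝕜] EuclideanSpace 𝕜 (Fin k))).2 rfl]
    · obtain ⟨μ, hμ, P, hreg, hPP, hP1, hrank, hone, hle⟩ :=
        exists_projection_twoSummingNorm_div_le hu
      exact hle.trans (le_sSup ⟨μ, hμ, P, hreg, hPP, hP1, hrank, hone, rfl⟩)
  · refine sSup_le ?_
    rintro r ⟨μ, hμ, P, -, -, -, hrank, hone, rfl⟩
    obtain ⟨u, hu, hun⟩ := exists_twoSummingNorm_eq_of_rank_le μ P hrank
    exact le_sSup ⟨u, by rw [hu, hun, hone]⟩
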